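/- Let $T_1,\dots,T_d$ be commuting, invertible, bimeasurable, measure preserving maps of a probability space $(E,\mathcal A,\mu)$, write $T^{\ell}f(x)=f(T_1^{\ell_1}\cdots T_d^{\ell_d}x)$ for $\ell\in\mathbb Z^d$, and let $f\in L^\infty(\mu)$ be real valued with $\int f\,d\mu=0$ and $\sum_{k\in\mathbb Z^d}\bigl|\int T^kf\cdot f\,d\mu\bigr|<\infty$. Then there is a (unique) continuous function $\varphi_f$ on $\mathbb T^d=(\mathbb R/\mathbb Z)^d$, the spectral density of $f$, with $\int T^kf\cdot f\,d\mu=\int_{\mathbb T^d}e^{2\pi i\langle k,t\rangle}\varphi_f(t)\,dt$ for all $k\in\mathbb Z^d$. For $j=1,\dots,s$ let $\xi_j$ be a probability measure on $\mathbb T^d$ and let $(w_{n,j})_{n}$ be a summation sequence, i.e. functions $w_{n,j}:\mathbb Z^d\to\mathbb R$ with $0<\sum_{\ell}|w_{n,j}(\ell)|<\infty$. Put $\|w_{n,j}\|_2^2=\sum_{\ell}w_{n,j}(\ell)^2$ and $W_{n,j}(t)=\sum_{\ell}w_{n,j}(\ell)e^{2\pi i\langle\ell,t\rangle}$. Assume: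 1. ($\xi_j$-regularity) for every $j$ and every continuous $\varphi$ on $\mathbb T^d$, $\displaystyle\lim_{n\to\infty}\|w_{n,j}\|_2^{-2}\int_{\mathbb T^d}|W_{n,j}(t)|^2\varphi(t)\,dt=\int\varphi\,d\xi_j=:\xi_j(\varphi)$; 2. (the weights are of the same order) $\|w_{n,j}\|_2^2=O(\|w_{n,j'}\|_2^2)$ as $n\to\infty$, for all $j,j'$; 3. (asymptotic orthogonality) for all $j\ne j'$ and all $p\in\mathbb Z^d$, $\displaystyle\int_{\mathbb T^d}W_{n,j}(t)\,\overline{W_{n,j'}(t)}\,e^{-2\pi i\langle p,t\rangle}\,dt=o\bigl(\|w_{n,j}\|_2^2+\|w_{n,j'}\|_2^2\bigr)$; 4. (negligible normalized cumulants of order $\ge3$) for all $r\ge3$ and all $(i_1,\dots,i_r)\in\{1,\dots,s\}^r$, $$\sum_{(\ell_1,\dots,\ell_r)\in(\mathbb Z^d)^r}w_{n,i_1}(\ell_1)\cdots w_{n,i_r}(\ell_r)\,C(T^{\ell_1}f,\dots,T^{\ell_r}f)=o\Bigl(\bigl(\|w_{n,1}\|_2^2+\dots+\|w_{n,s}\|_2^2\bigr)^{r/2}\Bigr),$$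 where $C(X_1,\dots,X_r)=\sum_{\Pi}(-1)^{|\Pi|-1}(|\Pi|-1)!\prod_{I\in\Pi}\mathbb E\bigl(\prod_{i\in I}X_i\bigr)$ is the joint cumulant, $\Pi$ running over the partitions of $\{1,\dots,r\}$ into nonempty sets. Then $\xi_j(\varphi_f)\ge0$ for every $j$, and, as $n\to\infty$, the random vectors $$\Bigl(\frac{\sum_{\ell}w_{n,1}(\ell)T^{\ell}f}{\|w_{n,1}\|_2},\dots,\frac{\sum_{\ell}w_{n,s}(\ell)T^{\ell}f}{\|w_{n,s}\|_2}\Bigr)$$ on $(E,\mu)$ converge in distribution to $\mathcal N(0,J_s)$, where $J_s$ is the diagonal matrix with diagonal entries $\xi_1(\varphi_f),\dots,\xi_s(\varphi_f)$. -/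

import Mathlib

open MeasureTheory ProbabilityTheory Filter Topology Asymptotics

noncomputable section

namespace WeightedCLT

/-- `ℤ^d`. -/
abbrev Lattice (d : ℕ) : Type := Fin d → ℤ

/-- `𝕋^d = (ℝ/ℤ)^d`. -/
abbrev Torus (d : ℕ) : Type := UnitAddTorus (Fin d)

/-- The normalized Lebesgue (Haar) measure `dt` on `𝕋^d`. -/
def torusMeasure (d : ℕ) : Measure (Torus d) :=
  Measure.pi fun _ : Fin d => AddCircle.haarAddCircle

section Action

variable {E : Type*} [MeasurableSpace E]

/-- `T^ℓ x = T₁^{ℓ₁} ⋯ T_d^{ℓ_d} x` (used for commuting invertible maps, so that the order of the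
factors is irrelevant). -/
def act {d : ℕ} (T : Fin d → E ≃ᵐ E) (l : Lattice d) : Equiv.Perm E :=
  (List.ofFn fun i => ((T i).toEquiv : Equiv.Perm E) ^ l i).prod

/-- `T₁, …, T_d` are commuting maps preserving `μ`. -/
structure IsCommutingAction {d : ℕ} (μ : Measure E) (T : Fin d → E ≃ᵐ E) : Prop where
  measurePreserving : ∀ i, MeasurePreserving (T i) μ μ
  commute : ∀ i j x, T i (T j x) = T j (T i x)

/-- The random field `X_ℓ = T^ℓ f`. -/
def field {d : ℕ} (T : Fin d → E ≃ᵐ E) (f : E → ℝ) (l : Lattice d) : E → ℝ :=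
  fun x => f (act T l x)

/-- The correlation `∫ T^k f · f dμ` (here `f` is real valued). -/
def correlation {d : ℕ} (μ : Measure E) (T : Fin d → E ≃ᵐ E) (f : E → ℝ) (k : Lattice d) : ℝ :=
  ∫ x, field T f k x * f x ∂μ

/-- The continuous function `φ` on `𝕋^d` is the spectral density of `f`:
`∫ T^k f · f dμ = ∫ e^{2πi⟨k,t⟩} φ(t) dt` for all `k`. Continuous functions on `𝕋^d` being
determined by their Fourier coefficients, there is at most one such `φ`. -/
def IsSpectralDensity {d : ℕ} (μ : Measure E) (T : Fin d → E ≃ᵐ E) (f : E → ℝ)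
    (φ : C(Torus d, ℝ)) : Prop :=
  ∀ k : Lattice d, ((correlation μ T f k : ℝ) : ℂ) =
    ∫ t, UnitAddTorus.mFourier k t * (φ t : ℂ) ∂(torusMeasure d)

/-- The joint cumulant of `(X_1, …, X_r)`, as the alternating sum over the partitions `P` of the
index set of `(-1)^{|P|-1} (|P|-1)! ∏_{I ∈ P} 𝔼 ∏_{i ∈ I} X_i` (used for `r ≥ 3`, so that
`|P| ≥ 1`). -/
def cumulant (μ : Measure E) {r : ℕ} (X : Fin r → E → ℝ) : ℝ :=
  ∑ P : Finpartition (Finset.univ : Finset (Fin r)),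
    (-1 : ℝ) ^ (P.parts.card - 1) * ((P.parts.card - 1).factorial : ℝ) *
      ∏ I ∈ P.parts, ∫ x, ∏ i ∈ I, X i x ∂μ

end Action

/-- A summation sequence: for each `n` a real function `w n` on `ℤ^d` with
`0 < ∑_ℓ |w_n(ℓ)| < ∞`. -/
def IsSummationSequence {d : ℕ} (w : ℕ → Lattice d → ℝ) : Prop :=
  ∀ n, Summable (fun l => |w n l|) ∧ 0 < ∑' l, |w n l|

/-- `∑_ℓ v(ℓ)²`. -/
def sqSum {d : ℕ} (v : Lattice d → ℝ) : ℝ := ∑' l, v l ^ 2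

/-- `t ↦ ∑_ℓ v(ℓ) e^{2πi⟨ℓ,t⟩}`. -/
def trigSum {d : ℕ} (v : Lattice d → ℝ) (t : Torus d) : ℂ :=
  ∑' l, (v l : ℂ) * UnitAddTorus.mFourier l t

/-- The normalized kernel `K(v)(t) = |∑_ℓ v(ℓ) e^{2πi⟨ℓ,t⟩}|² / ∑_ℓ v(ℓ)²`. -/
def kernel {d : ℕ} (v : Lattice d → ℝ) (t : Torus d) : ℝ :=
  ‖trigSum v t‖ ^ 2 / sqSum v

/-- `w` is `ξ`-regular: the measures `K(w_n) dt` converge weakly to `ξ`. -/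
def IsRegular {d : ℕ} (ξ : Measure (Torus d)) (w : ℕ → Lattice d → ℝ) : Prop :=
  ∀ φ : C(Torus d, ℝ),
    Tendsto (fun n => ∫ t, kernel (w n) t * φ t ∂(torusMeasure d)) atTop (𝓝 (∫ t, φ t ∂ξ))

/-- Asymptotic orthogonality of the summation sequences `w 1, …, w s`. -/
def AsymptoticallyOrthogonal {d s : ℕ} (w : Fin s → ℕ → Lattice d → ℝ) : Prop :=
  ∀ j j' : Fin s, j ≠ j' → ∀ p : Lattice d,
    (fun n => ∫ t, trigSum (w j n) t * (starRingEnd ℂ) (trigSum (w j' n) t) *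
        UnitAddTorus.mFourier (-p) t ∂(torusMeasure d))
      =o[atTop] fun n => sqSum (w j n) + sqSum (w j' n)

/-- Convergence to `0` of the normalized cumulants of order `≥ 3` of the field `X`. -/
def NegligibleCumulants {E : Type*} [MeasurableSpace E] {d s : ℕ} (μ : Measure E)
    (X : Lattice d → E → ℝ) (w : Fin s → ℕ → Lattice d → ℝ) : Prop :=
  ∀ r : ℕ, 3 ≤ r → ∀ i : Fin r → Fin s,
    (fun n => ∑' l : Fin r → Lattice d,
        (∏ k, w (i k) n (l k)) * cumulant μ (fun k => X (l k)))
      =o[atTop] fun n => (∑' l : Lattice d, ∑ j, w j n l ^ 2) ^ ((r : ℝ) / 2)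

/-- The vector with coordinates `∑_ℓ w_{n,j}(ℓ) X_ℓ / (∑_ℓ w_{n,j}(ℓ)²)^{1/2}`, `j = 1, …, s`. -/
def normalizedSums {E : Type*} {d s : ℕ} (X : Lattice d → E → ℝ)
    (w : Fin s → ℕ → Lattice d → ℝ) (n : ℕ) (x : E) : EuclideanSpace ℝ (Fin s) :=
  WithLp.toLp 2 fun j => (∑' l, w j n l * X l x) / Real.sqrt (sqSum (w j n))

end WeightedCLT

end

/-! This is the method of cumulants combined with Lévy's continuity theorem. For fixed real `a`, the
characteristic function of the normalized vector at `a` is `𝔼 exp(i Y_n)`, where `Y_n` is the linear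
combination of its coordinates with coefficients `a`. It suffices that the law of `Y_n` becomes
Gaussian, so three facts about `Y_n` are needed.

The mean is zero. The variance converges to `∑ a_j² ξ_j(φ)`: the covariance of two weighted sums is
the integral of `W_j · conj W_j'` against `φ`, so regularity gives the diagonal terms, and expanding
`φ` in its absolutely convergent Fourier series reduces the others to asymptotic orthogonality
(`tendsto_covariance`). Cumulants of order at least 3 tend to zero: by multilinearity they are
finite combinations of the sums assumed negligible, and comparability of the weights makes the
normalizations match (`tendsto_cumulant_linear_combination`).

The moment–cumulant recursion (`moment_succ_eq_sum`) turns this into convergence of all moments to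
Gaussian ones, and a Taylor bound for `exp(iy)` gives convergence of characteristic functions.
Boundedness of `f` supplies the moments and justifies every interchange of sum and integral. -/

namespace WeightedCLT

/-- The coefficient `(-1)^{q-1} (q-1)!` of a partition into `q` parts in the formula for cumulants. -/
noncomputable def cumulantCoeff (q : ℕ) : ℝ := (-1 : ℝ) ^ (q - 1) * ((q - 1).factorial : ℝ)

/-- The cumulant attached to the finite set `S` by the sequence of moments `m`. -/
noncomputable def partitionCumulant {α : Type*} [DecidableEq α] (m : ℕ → ℝ) (S : Finset α) : ℝ :=
  ∑ P : Finpartition S, cumulantCoeff P.parts.card * ∏ I ∈ P.parts, m I.card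

/-! ### Set partitions and the moment–cumulant recursion. -/

section Partition

variable {α : Type*} [DecidableEq α]

theorem parts_avoid_of_mem {S B : Finset α} (Q : Finpartition S) (hB : B ∈ Q.parts) :
    (Q.avoid B).parts = Q.parts.erase B := by
  ext C
  rw [Finpartition.mem_avoid, Finset.mem_erase]
  constructor
  · rintro ⟨D, hD, hDB, rfl⟩
    have hne : D ≠ B := fun h => hDB h.le
    have hd : Disjoint D B := Q.disjoint hD hB hne
    rw [Finset.sdiff_eq_self_of_disjoint hd]
    exact ⟨hne, hD⟩
  · rintro ⟨hne, hC⟩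
    have hd : Disjoint C B := Q.disjoint hC hB hne
    refine ⟨C, hC, fun h => Q.ne_bot hC (hd.eq_bot_of_le h), Finset.sdiff_eq_self_of_disjoint hd⟩

theorem notMem_parts_sdiff {S B : Finset α} (hB : B.Nonempty) (P : Finpartition (S \ B)) :
    B ∉ P.parts := by
  intro h
  obtain ⟨b, hb⟩ := hB
  have := P.subset h hb
  simp [hb] at this

/-- Partitions having `B` as a part correspond to partitions of the complement of `B`. -/
theorem sum_finpartition_mem_parts {S B : Finset α} (hBS : B ⊆ S) (hB : B.Nonempty)
    (F : Finset (Finset α) → ℝ) :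
    ∑ Q : Finpartition S with B ∈ Q.parts, F Q.parts =
      ∑ P : Finpartition (S \ B), F (insert B P.parts) := by
  refine Finset.sum_bij' (fun Q _ => Q.avoid B)
    (fun P _ => P.extend hB.ne_empty Finset.sdiff_disjoint (Finset.sdiff_union_of_subset hBS))
    ?_ ?_ ?_ ?_ ?_
  · intro Q _
    exact Finset.mem_univ _
  · intro P _
    simp
  · intro Q hQ
    have hQ' : B ∈ Q.parts := (Finset.mem_filter.1 hQ).2
    ext1
    rw [Finpartition.extend_parts, parts_avoid_of_mem Q hQ', Finset.insert_erase hQ']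
  · intro P _
    ext1
    rw [parts_avoid_of_mem _ (by simp), Finpartition.extend_parts,
      Finset.erase_insert (notMem_parts_sdiff hB P)]
  · intro Q hQ
    have hQ' : B ∈ Q.parts := (Finset.mem_filter.1 hQ).2
    rw [parts_avoid_of_mem Q hQ', Finset.insert_erase hQ']

/-- Exactly one part contains `a`. This count is the multiplicity of `Q` when the recursion is
summed over blocks avoiding `a`. -/
theorem card_filter_notMem_parts {S : Finset α} {a : α} (ha : a ∈ S) (Q : Finpartition S) :
    (Q.parts.filter (a ∉ ·)).card = Q.parts.card - 1 := by
  have : Q.parts.filter (a ∉ ·) = Q.parts.erase (Q.part a) := by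
    ext B
    rw [Finset.mem_filter, Finset.mem_erase]
    constructor
    · rintro ⟨h1, h2⟩
      refine ⟨?_, h1⟩
      rintro rfl
      exact h2 (Q.mem_part_self.2 ha)
    · rintro ⟨h1, h2⟩
      exact ⟨h2, fun h => h1 (Q.part_eq_of_mem h2 h).symm⟩
  rw [this, Finset.card_erase_of_mem (Q.part_mem.2 ha)]

/-- The cancellation `(-1)^{q-1}(q-1)! + (q-1)(-1)^{q-2}(q-2)! = 0` is what leaves only the
one-block partition; at `q = 1` the factor `q - 1` removes the second term. -/
theorem cumulantCoeff_add {q : ℕ} (hq : 0 < q) :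
    cumulantCoeff q + ((q - 1 : ℕ) : ℝ) * cumulantCoeff (q - 1) = if q = 1 then 1 else 0 := by
  obtain _ | _ | q := q
  · omega
  · simp [cumulantCoeff]
  · simp only [cumulantCoeff, Nat.add_sub_cancel, Nat.factorial_succ]
    rw [if_neg (by omega), pow_succ]
    push_cast
    ring

theorem sum_finpartition_single {S : Finset α} (hS : S.Nonempty) (F : Finset (Finset α) → ℝ) :
    ∑ Q : Finpartition S, (if Q.parts.card = 1 then F Q.parts else 0) = F {S} := by
  rw [Finset.sum_eq_single (Finpartition.indiscrete hS.ne_empty)]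
  · simp
  · intro Q _ hQ
    rw [if_neg]
    intro h
    apply hQ
    obtain ⟨B, hB⟩ := Finset.card_eq_one.1 h
    have := Q.sup_parts
    rw [hB] at this
    ext1
    rw [hB]
    simpa using this
  · intro h
    exact absurd (Finset.mem_univ _) h

/-- Moments in terms of cumulants. -/
theorem moment_eq_sum_partitionCumulant (m : ℕ → ℝ) (h0 : m 0 = 1) {S : Finset α} {a : α}
    (ha : a ∈ S) :
    m S.card = ∑ B ∈ (S.erase a).powerset, partitionCumulant m (S \ B) * m B.card := by
  have hne : S.Nonempty := ⟨a, ha⟩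
  -- The term `B = ∅` is the cumulant of `S` itself. In every other term, adjoining `B` to a
  -- partition of `S \ B` yields a partition of `S` having `B` as a part.
  rw [← Finset.add_sum_erase _ _ (Finset.empty_mem_powerset (S.erase a))]
  have h1 : ∀ B ∈ (S.erase a).powerset.erase ∅, partitionCumulant m (S \ B) * m B.card =
      ∑ Q : Finpartition S with B ∈ Q.parts, cumulantCoeff (Q.parts.card - 1) *
        ∏ I ∈ Q.parts, m I.card := by
    intro B hB
    rw [Finset.mem_erase, Finset.mem_powerset] at hB
    have hBn : B.Nonempty := Finset.nonempty_iff_ne_empty.2 hB.1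
    rw [sum_finpartition_mem_parts (hB.2.trans (Finset.erase_subset _ _)) hBn
      (fun R => cumulantCoeff (R.card - 1) * ∏ I ∈ R, m I.card), partitionCumulant,
      Finset.sum_mul]
    refine Finset.sum_congr rfl fun P _ => ?_
    have := notMem_parts_sdiff hBn P
    rw [Finset.card_insert_of_notMem this, Finset.prod_insert this, Nat.add_sub_cancel]
    ring
  rw [Finset.sum_congr rfl h1]
  simp_rw [Finset.sum_filter]
  rw [Finset.sum_comm]
  have h2 : ∀ Q : Finpartition S, ∑ B ∈ (S.erase a).powerset.erase ∅,
      (if B ∈ Q.parts then cumulantCoeff (Q.parts.card - 1) * ∏ I ∈ Q.parts, m I.card else 0) =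
      ((Q.parts.card - 1 : ℕ) : ℝ) *
        (cumulantCoeff (Q.parts.card - 1) * ∏ I ∈ Q.parts, m I.card) := by
    intro Q
    rw [← Finset.sum_filter, Finset.sum_const, nsmul_eq_mul, ← card_filter_notMem_parts ha Q]
    congr 3
    ext B
    simp only [Finset.mem_filter, Finset.mem_erase, Finset.mem_powerset]
    constructor
    · rintro ⟨⟨_, h⟩, h'⟩
      exact ⟨h', fun hh => by simpa using h hh⟩
    · rintro ⟨h, h'⟩
      exact ⟨⟨Q.ne_empty h, fun x hx => Finset.mem_erase.2
        ⟨fun e => h' (e ▸ hx), Q.subset h hx⟩⟩, h⟩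
  rw [Finset.sum_congr rfl fun Q _ => h2 Q]
  rw [Finset.card_empty, h0, mul_one, Finset.sdiff_empty, partitionCumulant,
    ← Finset.sum_add_distrib]
  have h3 : ∀ Q : Finpartition S, cumulantCoeff Q.parts.card * ∏ I ∈ Q.parts, m I.card +
      ((Q.parts.card - 1 : ℕ) : ℝ) *
        (cumulantCoeff (Q.parts.card - 1) * ∏ I ∈ Q.parts, m I.card) =
      if Q.parts.card = 1 then ∏ I ∈ Q.parts, m I.card else 0 := by
    intro Q
    have := cumulantCoeff_add (Finset.card_pos.2 (Q.parts_nonempty hne.ne_empty))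
    rw [← mul_assoc, ← add_mul, this]
    split_ifs <;> simp
  rw [Finset.sum_congr rfl fun Q _ => h3 Q,
    sum_finpartition_single hne fun R => ∏ I ∈ R, m I.card]
  simp

end Partition

/-- The cumulant of order `r` attached to the sequence of moments `m`. -/
noncomputable def cumulantOfMoments (m : ℕ → ℝ) (r : ℕ) : ℝ :=
  partitionCumulant m (Finset.univ : Finset (Fin r))

/-- Partition cumulants only depend on the cardinality. -/
theorem partitionCumulant_congr (m : ℕ → ℝ) (h0 : m 0 = 1) (n : ℕ) :
    ∀ {α β : Type} [DecidableEq α] [DecidableEq β] (S : Finset α) (S' : Finset β),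
      S.card = n → S'.card = n → partitionCumulant m S = partitionCumulant m S' := by
  induction n using Nat.strong_induction_on with
  | _ n ih =>
  intro α β _ _ S S' hS hS'
  obtain rfl | hn := Nat.eq_zero_or_pos n
  · rw [Finset.card_eq_zero] at hS hS'
    subst hS hS'
    -- The empty set has one partition, with no parts; its coefficient is 1 because `0 - 1 = 0` in
    -- `ℕ`.
    have key : ∀ {γ : Type} [DecidableEq γ], partitionCumulant m (∅ : Finset γ) = 1 := by
      intro γ _
      have h : ∀ P : Finpartition (∅ : Finset γ), P.parts = ∅ := fun P =>
        P.parts_eq_empty_iff.2 rfl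
      have hc : Fintype.card (Finpartition (∅ : Finset γ)) = 1 := by
        have : Unique (Finpartition (∅ : Finset γ)) :=
          inferInstanceAs (Unique (Finpartition (⊥ : Finset γ)))
        exact Fintype.card_unique
      simp [partitionCumulant, h, cumulantCoeff, hc]
    rw [key, key]
  -- Solving the recursion for its `B = ∅` term expresses the cumulant through smaller sets, which
  -- the induction hypothesis replaces by `Fin (n - j)`; the result depends on `n` alone.
  · have key : ∀ {γ : Type} [DecidableEq γ] (U : Finset γ) (a : γ), a ∈ U → U.card = n →
        partitionCumulant m U = m n - ∑ j ∈ (Finset.range n).erase 0, ((n - 1).choose j : ℝ) *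
          (partitionCumulant m (Finset.univ : Finset (Fin (n - j))) * m j) := by
      intro γ _ U a ha hU
      have h1 := moment_eq_sum_partitionCumulant m h0 ha
      rw [hU, ← Finset.add_sum_erase _ _ (Finset.empty_mem_powerset (U.erase a)),
        Finset.card_empty, h0, mul_one, Finset.sdiff_empty] at h1
      have h2 : ∑ B ∈ (U.erase a).powerset.erase ∅, partitionCumulant m (U \ B) * m B.card =
          ∑ B ∈ (U.erase a).powerset.erase ∅,
          (partitionCumulant m (Finset.univ : Finset (Fin (n - B.card))) * m B.card) := by
        refine Finset.sum_congr rfl fun B hB => ?_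
        rw [Finset.mem_erase, Finset.mem_powerset] at hB
        have hBU : B ⊆ U := hB.2.trans (Finset.erase_subset _ _)
        have hpos : 0 < B.card := Finset.card_pos.2 (Finset.nonempty_iff_ne_empty.2 hB.1)
        rw [ih (n - B.card) (by omega) (U \ B) (Finset.univ : Finset (Fin (n - B.card)))
          (by rw [Finset.card_sdiff_of_subset hBU, hU]) (by simp)]
      have hcard : (U.erase a).card + 1 = n := by rw [Finset.card_erase_add_one ha, hU]
      have h4 := Finset.sum_powerset_apply_card (x := U.erase a)
        (fun j => partitionCumulant m (Finset.univ : Finset (Fin (n - j))) * m j)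
      rw [← Finset.add_sum_erase _ _ (Finset.empty_mem_powerset (U.erase a)), hcard,
        ← Finset.add_sum_erase _ _ (Finset.mem_range.2 hn)] at h4
      simp only [Finset.card_empty, Nat.choose_zero_right, one_smul, nsmul_eq_mul] at h4
      replace h4 := add_left_cancel h4
      rw [h2, h4] at h1
      rw [h1, show (U.erase a).card = n - 1 by omega]
      ring
    obtain ⟨a, ha⟩ := Finset.card_pos.1 (hS.symm ▸ hn)
    obtain ⟨b, hb⟩ := Finset.card_pos.1 (hS'.symm ▸ hn)
    rw [key S a ha hS, key S' b hb hS']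

/-- The recursion expressing moments through cumulants. -/
theorem moment_succ_eq_sum (m : ℕ → ℝ) (h0 : m 0 = 1) (n : ℕ) :
    m (n + 1) = ∑ j ∈ Finset.range (n + 1), (n.choose j : ℝ) *
      (cumulantOfMoments m (n + 1 - j) * m j) := by
  have h1 := moment_eq_sum_partitionCumulant m h0 (Finset.mem_univ (0 : Fin (n + 1)))
  rw [Finset.card_univ, Fintype.card_fin] at h1
  rw [h1]
  have hcard : ((Finset.univ : Finset (Fin (n + 1))).erase 0).card = n := by simp
  have h4 := Finset.sum_powerset_apply_card (x := (Finset.univ : Finset (Fin (n + 1))).erase 0)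
    (fun j => cumulantOfMoments m (n + 1 - j) * m j)
  rw [hcard] at h4
  simp only [nsmul_eq_mul] at h4
  rw [← h4]
  refine Finset.sum_congr rfl fun B hB => ?_
  rw [cumulantOfMoments, partitionCumulant_congr m h0 (n + 1 - B.card) (Finset.univ \ B)
    (Finset.univ : Finset (Fin (n + 1 - B.card)))
    (by rw [Finset.card_sdiff_of_subset (Finset.subset_univ _)]; simp) (by simp)]

/-! ### From cumulants to Gaussian moments. -/

section GaussianMoments

/-- The moments of the centered Gaussian law of variance `v`. -/
noncomputable def gaussianMoment (v : ℝ) : ℕ → ℝ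
  | 0 => 1
  | 1 => 0
  | (n + 2) => (n + 1) * v * gaussianMoment v n

theorem cumulantOfMoments_one (m : ℕ → ℝ) (h0 : m 0 = 1) : cumulantOfMoments m 1 = m 1 := by
  have := moment_succ_eq_sum m h0 0
  simpa [h0] using this.symm

theorem cumulantOfMoments_two (m : ℕ → ℝ) (h0 : m 0 = 1) (h1 : m 1 = 0) :
    cumulantOfMoments m 2 = m 2 := by
  have := moment_succ_eq_sum m h0 1
  simpa [h0, h1, Finset.sum_range_succ] using this.symm

/-- Pass to the limit in the recursion for the moment of order `r + 2`. Only the second cumulant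
survives, hence only `j = r`, with binomial factor `r + 1`: this is the recursion defining
`gaussianMoment`. -/
theorem tendsto_gaussianMoment {m : ℕ → ℕ → ℝ} {v : ℝ} (h0 : ∀ n, m n 0 = 1)
    (h1 : ∀ n, m n 1 = 0) (h2 : Tendsto (fun n => m n 2) atTop (𝓝 v))
    (hk : ∀ r, 3 ≤ r → Tendsto (fun n => cumulantOfMoments (m n) r) atTop (𝓝 0)) (r : ℕ) :
    Tendsto (fun n => m n r) atTop (𝓝 (gaussianMoment v r)) := by
  induction r using Nat.strong_induction_on with
  | _ r ih =>
  match r, ih with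
  | 0, _ => simp [h0, gaussianMoment]
  | 1, _ => simp [h1, gaussianMoment]
  | r + 2, ih =>
    have hl : ∀ i, 1 ≤ i → Tendsto (fun n => cumulantOfMoments (m n) i) atTop
        (𝓝 (if i = 2 then v else 0)) := by
      intro i hi
      obtain rfl | rfl | h3 : i = 1 ∨ i = 2 ∨ 3 ≤ i := by omega
      · simp [cumulantOfMoments_one _ (h0 _), h1]
      · simpa [cumulantOfMoments_two _ (h0 _) (h1 _)] using h2
      · rw [if_neg (by omega)]
        exact hk i h3
    have hsum : Tendsto (fun n => ∑ j ∈ Finset.range (r + 1 + 1), ((r + 1).choose j : ℝ) *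
        (cumulantOfMoments (m n) (r + 1 + 1 - j) * m n j)) atTop
        (𝓝 (∑ j ∈ Finset.range (r + 1 + 1), ((r + 1).choose j : ℝ) *
          ((if r + 1 + 1 - j = 2 then v else 0) * gaussianMoment v j))) := by
      refine tendsto_finsetSum _ fun j hj => ?_
      have hj' := Finset.mem_range.1 hj
      exact ((hl _ (by omega)).mul (ih j hj')).const_mul _
    have heq : ∑ j ∈ Finset.range (r + 1 + 1), ((r + 1).choose j : ℝ) *
          ((if r + 1 + 1 - j = 2 then v else 0) * gaussianMoment v j) =
          gaussianMoment v (r + 2) := by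
      rw [Finset.sum_eq_single r]
      · rw [if_pos (by omega), Nat.choose_succ_self_right, gaussianMoment]
        push_cast
        ring
      · intro j hj hjr
        have := Finset.mem_range.1 hj
        rw [if_neg (by omega)]
        ring
      · intro h
        exact absurd (Finset.mem_range.2 (by omega)) h
    rw [heq] at hsum
    exact hsum.congr fun n => (moment_succ_eq_sum (m n) (h0 n) (r + 1)).symm

theorem gaussianMoment_two_mul (v : ℝ) (k : ℕ) :
    gaussianMoment v (2 * k) / ((2 * k).factorial : ℝ) = (v / 2) ^ k / (k.factorial : ℝ) := by
  induction k with
  | zero => simp [gaussianMoment]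
  | succ k ih =>
    rw [show 2 * (k + 1) = 2 * k + 2 by ring, gaussianMoment, Nat.factorial_succ,
      Nat.factorial_succ, Nat.factorial_succ, pow_succ]
    rw [div_eq_iff (by positivity)] at ih
    rw [ih]
    push_cast
    field_simp
    ring

theorem gaussianMoment_two_mul_add_one (v : ℝ) (k : ℕ) : gaussianMoment v (2 * k + 1) = 0 := by
  induction k with
  | zero => simp [gaussianMoment]
  | succ k ih =>
    rw [show 2 * (k + 1) + 1 = (2 * k + 1) + 2 by ring, gaussianMoment, ih, mul_zero]

/-- Odd moments vanish, and the even ones divided by `(2k)!` are the Taylor terms of `exp(v/2)`; the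
factor `I ^ (2k)` supplies the sign. -/
theorem sum_gaussianMoment (v : ℝ) (K : ℕ) :
    ∑ j ∈ Finset.range (2 * K), Complex.I ^ j * (gaussianMoment v j : ℂ) / (j.factorial : ℂ) =
      ∑ k ∈ Finset.range K, (-(v : ℂ) / 2) ^ k / (k.factorial : ℂ) := by
  induction K with
  | zero => simp
  | succ K ih =>
    rw [show 2 * (K + 1) = 2 * K + 1 + 1 by ring, Finset.sum_range_succ, Finset.sum_range_succ, ih,
      Finset.sum_range_succ, gaussianMoment_two_mul_add_one]
    have := congrArg (fun x : ℝ => (x : ℂ)) (gaussianMoment_two_mul v K)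
    simp only [Complex.ofReal_div, Complex.ofReal_pow, Complex.ofReal_natCast,
      Complex.ofReal_ofNat] at this
    rw [mul_div_assoc, this, pow_mul, Complex.I_sq, neg_div, neg_pow ((v : ℂ) / 2)]
    simp
    ring

end GaussianMoments

/-! ### Taylor bound for `exp(iy)` and the method of moments. -/

section Taylor

/-- Induction on the order: the next remainder has derivative `i` times the current one, the next
bound has the current bound as derivative, and both vanish at 0. -/
theorem norm_exp_mul_I_sub_sum_le_of_nonneg (N : ℕ) :
    ∀ y : ℝ, 0 ≤ y → ‖Complex.exp (y * Complex.I) -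
      ∑ k ∈ Finset.range N, (y * Complex.I) ^ k / (k.factorial : ℂ)‖ ≤ y ^ N / N.factorial := by
  induction N with
  | zero => intro y _; simp [Complex.norm_exp_ofReal_mul_I]
  | succ N ih =>
    intro y hy
    have hderiv : ∀ x : ℝ, HasDerivAt (fun y : ℝ => Complex.exp (y * Complex.I) -
        ∑ k ∈ Finset.range (N + 1), (y * Complex.I) ^ k / (k.factorial : ℂ))
        (Complex.I * (Complex.exp (x * Complex.I) -
          ∑ k ∈ Finset.range N, (x * Complex.I) ^ k / (k.factorial : ℂ))) x := by
      intro x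
      have hlin : HasDerivAt (fun y : ℝ => (y : ℂ) * Complex.I) Complex.I x := by
        simpa using (Complex.ofRealCLM.hasDerivAt (x := x)).mul_const Complex.I
      have h1 := hlin.cexp
      have h2 : HasDerivAt (fun y : ℝ => ∑ k ∈ Finset.range (N + 1),
          ((y : ℂ) * Complex.I) ^ k / (k.factorial : ℂ))
          (∑ k ∈ Finset.range (N + 1), ((k : ℂ) * ((x : ℂ) * Complex.I) ^ (k - 1) * Complex.I) /
            (k.factorial : ℂ)) x :=
        HasDerivAt.fun_sum fun k _ => (hlin.pow k).div_const _
      convert! h1.sub h2 using 1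
      rw [Finset.sum_range_succ', mul_sub, Finset.mul_sum]
      simp only [Nat.cast_zero, zero_mul, zero_div, add_zero]
      congr 1
      · ring
      · refine Finset.sum_congr rfl fun k _ => ?_
        rw [Nat.factorial_succ]
        have : (k.factorial : ℂ) ≠ 0 := by exact_mod_cast k.factorial_ne_zero
        have : ((k : ℂ) + 1) ≠ 0 := by exact_mod_cast k.succ_ne_zero
        push_cast
        field_simp
    have hB : ∀ x : ℝ, HasDerivAt (fun y : ℝ => y ^ (N + 1) / ((N + 1).factorial : ℝ))
        (x ^ N / N.factorial) x := by
      intro x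
      convert! (hasDerivAt_pow (N + 1) x).div_const ((N + 1).factorial : ℝ) using 1
      rw [Nat.factorial_succ]
      push_cast
      field_simp
    refine image_norm_le_of_norm_deriv_right_le_deriv_boundary' (a := 0) (b := y)
      (f := fun y : ℝ => Complex.exp (y * Complex.I) -
        ∑ k ∈ Finset.range (N + 1), (y * Complex.I) ^ k / (k.factorial : ℂ))
      (f' := fun x => Complex.I * (Complex.exp (x * Complex.I) -
          ∑ k ∈ Finset.range N, (x * Complex.I) ^ k / (k.factorial : ℂ)))
      (B := fun y : ℝ => y ^ (N + 1) / ((N + 1).factorial : ℝ))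
      (B' := fun x => x ^ N / N.factorial) ?_ ?_ ?_ ?_ ?_ ?_ ⟨hy, le_rfl⟩
    · exact fun x _ => (hderiv x).continuousAt.continuousWithinAt
    · exact fun x _ => (hderiv x).hasDerivWithinAt
    · simp [Finset.sum_range_succ']
    · exact fun x _ => (hB x).continuousAt.continuousWithinAt
    · exact fun x _ => (hB x).hasDerivWithinAt
    · intro x hx
      rw [norm_mul, Complex.norm_I, one_mul]
      exact ih x hx.1

theorem norm_exp_mul_I_sub_sum_le (N : ℕ) (y : ℝ) :
    ‖Complex.exp (y * Complex.I) -
      ∑ k ∈ Finset.range N, (y * Complex.I) ^ k / (k.factorial : ℂ)‖ ≤ |y| ^ N / N.factorial := by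
  obtain hy | hy := le_total 0 y
  · rw [abs_of_nonneg hy]
    exact norm_exp_mul_I_sub_sum_le_of_nonneg N y hy
  · rw [abs_of_nonpos hy]
    refine le_of_eq_of_le ?_ (norm_exp_mul_I_sub_sum_le_of_nonneg N (-y) (by linarith))
    rw [← Complex.norm_conj]
    congr 1
    simp [← Complex.exp_conj]

end Taylor

/-- Convergence of the characteristic function from convergence of moments to those of a
Gaussian law. -/
theorem tendsto_integral_exp_of_tendsto_moments {E : Type*} [MeasurableSpace E] {μ : Measure E}
    {Y : ℕ → E → ℝ} {v : ℝ} (hY : ∀ n, AEMeasurable (Y n) μ)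
    (hint : ∀ n r, Integrable (fun x => Y n x ^ r) μ)
    (hmom : ∀ r, Tendsto (fun n => ∫ x, Y n x ^ r ∂μ) atTop (𝓝 (gaussianMoment v r))) :
    Tendsto (fun n => ∫ x, Complex.exp (Y n x * Complex.I) ∂μ) atTop
      (𝓝 (Complex.exp (-(v : ℂ) / 2))) := by
  have hconst : IsFiniteMeasure μ := by
    have := hint 0 0
    simpa [integrable_const_iff] using this
  have hbound : ∀ n K, ‖∫ x, Complex.exp (Y n x * Complex.I) ∂μ -
      ∑ j ∈ Finset.range (2 * K), Complex.I ^ j * ((∫ x, Y n x ^ j ∂μ : ℝ) : ℂ) /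
        (j.factorial : ℂ)‖ ≤ (∫ x, Y n x ^ (2 * K) ∂μ) / ((2 * K).factorial : ℝ) := by
    intro n K
    have hterm : ∀ j, Integrable (fun x => ((Y n x : ℂ) * Complex.I) ^ j / (j.factorial : ℂ)) μ := by
      intro j
      have : (fun x => ((Y n x : ℂ) * Complex.I) ^ j / (j.factorial : ℂ)) =
          fun x => ((Y n x ^ j : ℝ) : ℂ) * (Complex.I ^ j / (j.factorial : ℂ)) := by
        ext x
        push_cast
        rw [mul_pow]
        ring
      rw [this]
      exact (hint n j).ofReal.mul_const _
    have hexp : Integrable (fun x => Complex.exp (Y n x * Complex.I)) μ := by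
      refine Integrable.of_bound (C := 1) ?_ (ae_of_all _ fun x => ?_)
      · have := hY n
        exact AEMeasurable.aestronglyMeasurable (by fun_prop)
      · rw [Complex.norm_exp_ofReal_mul_I]
    have hsum : ∑ j ∈ Finset.range (2 * K), Complex.I ^ j * ((∫ x, Y n x ^ j ∂μ : ℝ) : ℂ) /
        (j.factorial : ℂ) = ∫ x, ∑ j ∈ Finset.range (2 * K),
          ((Y n x : ℂ) * Complex.I) ^ j / (j.factorial : ℂ) ∂μ := by
      rw [integral_finsetSum _ fun j _ => hterm j]
      refine Finset.sum_congr rfl fun j _ => ?_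
      rw [← integral_complex_ofReal, ← integral_const_mul, ← integral_div]
      refine integral_congr_ae (ae_of_all _ fun x => ?_)
      push_cast
      simp only [mul_pow]
      ring
    rw [hsum, ← integral_sub hexp (integrable_finsetSum _ fun j _ => hterm j), ← integral_div]
    refine norm_integral_le_of_norm_le ((hint n _).div_const _) (ae_of_all _ fun x => ?_)
    refine (norm_exp_mul_I_sub_sum_le (2 * K) (Y n x)).trans (le_of_eq ?_)
    -- The truncation order is even so that the error is an ordinary moment, without absolute
    -- values.
    rw [pow_mul, pow_mul, sq_abs]
  rw [Metric.tendsto_atTop]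
  intro ε hε
  have hser : Tendsto (fun K => ∑ k ∈ Finset.range K, (-(v : ℂ) / 2) ^ k / (k.factorial : ℂ)) atTop
      (𝓝 (Complex.exp (-(v : ℂ) / 2))) := by
    have := (NormedSpace.expSeries_div_hasSum_exp (𝔸 := ℂ) (-(v : ℂ) / 2)).tendsto_sum_nat
    rwa [← Complex.exp_eq_exp_ℂ] at this
  have htail : Tendsto (fun K => gaussianMoment v (2 * K) / ((2 * K).factorial : ℝ)) atTop
      (𝓝 0) := by
    simp_rw [gaussianMoment_two_mul]
    exact FloorSemiring.tendsto_pow_div_factorial_atTop (v / 2)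
  -- The order `K` is fixed first, from the Gaussian limit alone; only then is `n` taken large, so
  -- finitely many moments matter. Three errors below `ε / 4` remain.
  obtain ⟨K, hK1, hK2⟩ := ((Metric.tendsto_nhds.1 hser (ε / 4) (by linarith)).and
    (htail.eventually (gt_mem_nhds (show (0 : ℝ) < ε / 4 by linarith)))).exists
  have hpart : Tendsto (fun n => ∑ j ∈ Finset.range (2 * K),
      Complex.I ^ j * ((∫ x, Y n x ^ j ∂μ : ℝ) : ℂ) / (j.factorial : ℂ)) atTop
      (𝓝 (∑ j ∈ Finset.range (2 * K),
        Complex.I ^ j * (gaussianMoment v j : ℂ) / (j.factorial : ℂ))) := by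
    refine tendsto_finsetSum _ fun j _ => ?_
    exact (((Complex.continuous_ofReal.tendsto _).comp (hmom j)).const_mul _).div_const _
  rw [sum_gaussianMoment] at hpart
  have hrem : Tendsto (fun n => (∫ x, Y n x ^ (2 * K) ∂μ) / ((2 * K).factorial : ℝ)) atTop
      (𝓝 (gaussianMoment v (2 * K) / ((2 * K).factorial : ℝ))) := (hmom _).div_const _
  obtain ⟨N, hN⟩ := eventually_atTop.1 ((Metric.tendsto_nhds.1 hpart (ε / 4) (by linarith)).and
    (hrem.eventually (gt_mem_nhds hK2)))
  refine ⟨N, fun n hn => ?_⟩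
  obtain ⟨h1, h2⟩ := hN n hn
  have h3 := (hbound n K).trans_lt h2
  rw [← dist_eq_norm] at h3
  have h4 := (dist_triangle _ _ _).trans_lt (add_lt_add h3 ((dist_triangle _ _ _).trans_lt
    (add_lt_add h1 hK1)))
  linarith

/-! ### Interchanging integrals with products of series. -/

section Expansion

variable {𝕜 : Type*} [RCLike 𝕜] {ι : Type*}

theorem hasSum_prod_fin {r : ℕ} (v : Fin r → ι → 𝕜) (hv : ∀ k, Summable fun i => ‖v k i‖) :
    (Summable fun l : Fin r → ι => ‖∏ k, v k (l k)‖) ∧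
      HasSum (fun l : Fin r → ι => ∏ k, v k (l k)) (∏ k, ∑' i, v k i) := by
  induction r with
  | zero => exact ⟨(hasSum_fintype _).summable, by simp⟩
  | succ r ih =>
    obtain ⟨h1, h2⟩ := ih (fun k => v k.succ) fun k => hv k.succ
    have hn := (hv 0).mul_norm h1
    constructor
    · rw [← (Fin.consEquiv fun _ => ι).summable_iff]
      refine hn.congr fun p => ?_
      simp [Fin.prod_univ_succ, Fin.consEquiv]
    · rw [← (Fin.consEquiv fun _ => ι).hasSum_iff]
      have := ((hv 0).of_norm.hasSum.mul h2 hn.of_norm)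
      rw [Fin.prod_univ_succ]
      refine this.congr_fun fun p => ?_
      simp [Fin.prod_univ_succ, Fin.consEquiv]

theorem norm_mul_le_of_le_bound {a b : 𝕜} {M : ℝ} (hb : ‖b‖ ≤ M) : ‖a * b‖ ≤ ‖a‖ * M := by
  rw [norm_mul]
  exact mul_le_mul_of_nonneg_left hb (norm_nonneg _)

/-- The integral of a product of absolutely convergent series of bounded functions. -/
theorem hasSum_integral_prod [Countable ι] {Ω : Type*} [MeasurableSpace Ω] {μ : Measure Ω}
    [IsFiniteMeasure μ] {r : ℕ} (v : Fin r → ι → 𝕜) (hv : ∀ k, Summable fun i => ‖v k i‖)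
    (Z : Fin r → ι → Ω → 𝕜) (hZ : ∀ k i, AEStronglyMeasurable (Z k i) μ) {M : ℝ}
    (hM : ∀ k i, ∀ᵐ x ∂μ, ‖Z k i x‖ ≤ M) :
    HasSum (fun l : Fin r → ι => (∏ k, v k (l k)) * ∫ x, ∏ k, Z k (l k) x ∂μ)
      (∫ x, ∏ k, ∑' i, v k i * Z k i x ∂μ) := by
  have hM' : ∀ᵐ x ∂μ, ∀ k i, ‖Z k i x‖ ≤ M := by
    rw [ae_all_iff]; intro k; rw [ae_all_iff]; exact hM k
  have hsum := (hasSum_prod_fin v hv).1.mul_right (M ^ r)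
  have := hasSum_integral_of_dominated_convergence (μ := μ)
    (F := fun (l : Fin r → ι) x => ∏ k, (v k (l k) * Z k (l k) x))
    (f := fun x => ∏ k, ∑' i, v k i * Z k i x)
    (fun l _ => ‖∏ k, v k (l k)‖ * M ^ r) ?_ ?_ ?_ ?_ ?_
  · refine this.congr_fun fun l => ?_
    rw [← integral_const_mul]
    simp_rw [Finset.prod_mul_distrib]
  · intro l
    exact Finset.aestronglyMeasurable_fun_prod _ fun k _ => (hZ k (l k)).const_mul _
  · intro l
    filter_upwards [hM'] with x hx
    rw [Finset.prod_mul_distrib]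
    refine norm_mul_le_of_le_bound ?_
    rw [norm_prod]
    refine (Finset.prod_le_prod (fun _ _ => norm_nonneg _) fun k _ => hx k (l k)).trans ?_
    simp
  · exact ae_of_all _ fun _ => hsum
  · exact integrable_const _
  · filter_upwards [hM'] with x hx
    refine (hasSum_prod_fin (fun k i => v k i * Z k i x) fun k => ?_).2
    exact Summable.of_nonneg_of_le (fun _ => norm_nonneg _)
      (fun i => norm_mul_le_of_le_bound (hx k i)) ((hv k).mul_right M)

end Expansion

/-! ### Multilinearity of cumulants. -/

section Cumulant

variable {E : Type*} [MeasurableSpace E] {μ : Measure E} [IsProbabilityMeasure μ]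

/-- Giving each block its own independent copy of the space makes the product of expectations a
single integral, so `hasSum_integral_prod` handles every partition at once. -/
theorem prod_integral_parts {r : ℕ} (P : Finpartition (Finset.univ : Finset (Fin r)))
    (X : Fin r → E → ℝ) :
    ∏ I ∈ P.parts, ∫ x, ∏ i ∈ I, X i x ∂μ =
      ∫ ω, ∏ k, X k (ω ⟨P.part k, P.part_mem.2 (Finset.mem_univ k)⟩)
        ∂(Measure.pi fun _ : P.parts => μ) := by
  have h1 : ∀ ω : P.parts → E, ∏ k, X k (ω ⟨P.part k, P.part_mem.2 (Finset.mem_univ k)⟩) =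
      ∏ I : P.parts, ∏ i ∈ I.1, X i (ω I) := by
    intro ω
    rw [← Finset.prod_fiberwise Finset.univ
      (fun k => (⟨P.part k, P.part_mem.2 (Finset.mem_univ k)⟩ : P.parts))]
    refine Finset.prod_congr rfl fun I _ => ?_
    have : (Finset.univ.filter fun k =>
        (⟨P.part k, P.part_mem.2 (Finset.mem_univ k)⟩ : P.parts) = I) = I.1 := by
      ext k
      simp only [Finset.mem_filter, Finset.mem_univ, true_and, Subtype.ext_iff]
      exact P.part_eq_iff_mem I.2
    rw [← this]
    refine Finset.prod_congr (by rw [this]) fun k hk => ?_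
    rw [this] at hk
    congr 2
    exact Subtype.ext ((P.part_eq_iff_mem I.2).2 hk)
  simp_rw [h1]
  rw [integral_fintype_prod_eq_prod (fun (I : P.parts) x => ∏ i ∈ I.1, X i x),
    Finset.prod_coe_sort P.parts fun I => ∫ x, ∏ i ∈ I, X i x ∂μ]

/-- Multilinear expansion of the cumulants of a series of bounded random variables. -/
theorem hasSum_cumulant {ι : Type*} [Countable ι] {X : ι → E → ℝ}
    (hX : ∀ i, AEStronglyMeasurable (X i) μ) {M : ℝ} (hM : ∀ i, ∀ᵐ x ∂μ, ‖X i x‖ ≤ M)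
    {v : ι → ℝ} (hv : Summable fun i => ‖v i‖) (r : ℕ) :
    HasSum (fun l : Fin r → ι => (∏ k, v (l k)) * cumulant μ fun k => X (l k))
      (cumulant μ fun _ : Fin r => fun x => ∑' i, v i * X i x) := by
  simp only [cumulant, Finset.mul_sum]
  refine hasSum_sum fun P _ => ?_
  rw [prod_integral_parts P]
  have hev : ∀ I : P.parts, MeasurePreserving (Function.eval I)
      (Measure.pi fun _ : P.parts => μ) μ := fun I => measurePreserving_eval (fun _ => μ) I
  have := hasSum_integral_prod (μ := Measure.pi fun _ : P.parts => μ) (r := r)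
    (fun _ => v) (fun _ => hv)
    (fun k i ω => X i (ω ⟨P.part k, P.part_mem.2 (Finset.mem_univ k)⟩))
    (fun k i => (hX i).comp_measurePreserving (hev _)) (M := M)
    (fun k i => (hev _).quasiMeasurePreserving.ae (hM i))
  refine (this.mul_left ((-1 : ℝ) ^ (P.parts.card - 1) *
    ((P.parts.card - 1).factorial : ℝ))).congr_fun fun l => ?_
  rw [prod_integral_parts P]
  ring

end Cumulant

theorem cumulant_const {E : Type*} [MeasurableSpace E] (μ : Measure E) (Y : E → ℝ) (r : ℕ) :
    cumulant μ (fun _ : Fin r => Y) = cumulantOfMoments (fun j => ∫ x, Y x ^ j ∂μ) r := by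
  simp [cumulant, cumulantOfMoments, partitionCumulant, cumulantCoeff]

/-- The method of cumulants: convergence of characteristic functions to a Gaussian limit. -/
theorem tendsto_integral_exp_of_tendsto_cumulant {E : Type*} [MeasurableSpace E] {μ : Measure E}
    [IsProbabilityMeasure μ] {Y : ℕ → E → ℝ} {v : ℝ} (hY : ∀ n, AEMeasurable (Y n) μ)
    (hb : ∀ n, ∃ M, ∀ᵐ x ∂μ, |Y n x| ≤ M) (h1 : ∀ n, ∫ x, Y n x ∂μ = 0)
    (h2 : Tendsto (fun n => ∫ x, Y n x ^ 2 ∂μ) atTop (𝓝 v))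
    (hk : ∀ r, 3 ≤ r → Tendsto (fun n => cumulant μ fun _ : Fin r => Y n) atTop (𝓝 0)) :
    Tendsto (fun n => ∫ x, Complex.exp (Y n x * Complex.I) ∂μ) atTop
      (𝓝 (Complex.exp (-(v : ℂ) / 2))) := by
  refine tendsto_integral_exp_of_tendsto_moments hY ?_ fun r => ?_
  · intro n r
    obtain ⟨M, hM⟩ := hb n
    refine Integrable.of_bound (C := M ^ r) ((hY n).pow_const r).aestronglyMeasurable ?_
    filter_upwards [hM] with x hx
    rw [norm_pow]
    exact pow_le_pow_left₀ (norm_nonneg _) hx r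
  · refine tendsto_gaussianMoment (m := fun n r => ∫ x, Y n x ^ r ∂μ) (fun n => by simp)
      (fun n => by simpa using h1 n) h2 (fun r hr => ?_) r
    simpa only [cumulant_const] using hk r hr

/-! ### The group action and stationarity. -/

section Action

variable {E : Type*} [MeasurableSpace E] {μ : Measure E} {d : ℕ} {T : Fin d → E ≃ᵐ E}

theorem prod_ofFn_zpow_add {G : Type*} [Group G] {n : ℕ} (a : Fin n → G)
    (ha : ∀ i j, Commute (a i) (a j)) (k l : Fin n → ℤ) :
    (List.ofFn fun i => a i ^ (k i + l i)).prod =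
      (List.ofFn fun i => a i ^ k i).prod * (List.ofFn fun i => a i ^ l i).prod := by
  induction n with
  | zero => simp
  | succ n ih =>
    have hc : Commute (List.ofFn fun i : Fin n => a i.succ ^ k i.succ).prod (a 0 ^ l 0) := by
      refine Commute.list_prod_left _ _ fun y hy => ?_
      obtain ⟨i, rfl⟩ := List.mem_ofFn.1 hy
      exact (ha _ _).zpow_zpow _ _
    simp only [List.ofFn_succ, List.prod_cons]
    rw [ih (fun i => a i.succ) (fun i j => ha _ _) (fun i => k i.succ) fun i => l i.succ, zpow_add,
      mul_assoc, mul_assoc, ← mul_assoc (a 0 ^ l 0), ← hc.eq, mul_assoc]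

theorem act_add (hT : IsCommutingAction μ T) (k l : Lattice d) :
    act T (k + l) = act T k * act T l := by
  refine prod_ofFn_zpow_add (fun i => ((T i).toEquiv : Equiv.Perm E)) (fun i j => ?_) k l
  ext x
  exact hT.commute i j x

theorem measurePreserving_zpow {e : E ≃ᵐ E} (he : MeasurePreserving e μ μ) (n : ℤ) :
    MeasurePreserving ((e.toEquiv : Equiv.Perm E) ^ n : Equiv.Perm E) μ μ := by
  obtain ⟨n, rfl | rfl⟩ := n.eq_nat_or_neg
  · rw [zpow_natCast, Equiv.Perm.coe_pow]
    exact he.iterate n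
  · rw [zpow_neg, zpow_natCast, ← inv_pow, Equiv.Perm.coe_pow]
    exact (MeasurePreserving.symm e he).iterate n

theorem measurePreserving_act (hT : IsCommutingAction μ T) (l : Lattice d) :
    MeasurePreserving (act T l) μ μ := by
  have key : ∀ L : List (Equiv.Perm E), (∀ g ∈ L, MeasurePreserving g μ μ) →
      MeasurePreserving L.prod μ μ := by
    intro L
    induction L with
    | nil => intro _; exact MeasurePreserving.id μ
    | cons g L ih =>
      intro h
      rw [List.prod_cons, Equiv.Perm.coe_mul]
      exact (h g (by simp)).comp (ih fun g' hg' => h g' (by simp [hg']))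
  refine key _ fun g hg => ?_
  obtain ⟨i, rfl⟩ := List.mem_ofFn.1 hg
  exact measurePreserving_zpow (hT.measurePreserving i) _

theorem aestronglyMeasurable_field (hT : IsCommutingAction μ T) {f : E → ℝ}
    (hf : AEStronglyMeasurable f μ) (l : Lattice d) : AEStronglyMeasurable (field T f l) μ :=
  hf.comp_measurePreserving (measurePreserving_act hT l)

theorem integral_field_mul_field (hT : IsCommutingAction μ T) {f : E → ℝ}
    (hf : AEStronglyMeasurable f μ) (k l : Lattice d) :
    ∫ x, field T f k x * field T f l x ∂μ = correlation μ T f (k - l) := by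
  have hl := measurePreserving_act hT l
  have h : ∫ x, field T f (k - l) x * f x ∂(μ.map (act T l)) =
      ∫ x, field T f (k - l) (act T l x) * f (act T l x) ∂μ := by
    refine integral_map hl.aemeasurable ?_
    rw [hl.map_eq]
    exact (aestronglyMeasurable_field hT hf _).mul hf
  rw [hl.map_eq] at h
  rw [correlation, h]
  refine integral_congr_ae (ae_of_all _ fun x => ?_)
  simp only [field]
  rw [← Equiv.Perm.mul_apply, ← act_add hT, sub_add_cancel]

theorem correlation_neg (hT : IsCommutingAction μ T) {f : E → ℝ}
    (hf : AEStronglyMeasurable f μ) (k : Lattice d) :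
    correlation μ T f (-k) = correlation μ T f k := by
  have h := integral_field_mul_field hT hf 0 k
  have h' := integral_field_mul_field hT hf k 0
  rw [zero_sub] at h
  rw [sub_zero] at h'
  rw [← h, ← h']
  simp_rw [mul_comm]

theorem integral_field (hT : IsCommutingAction μ T) {f : E → ℝ}
    (hf : AEStronglyMeasurable f μ) (l : Lattice d) : ∫ x, field T f l x ∂μ = ∫ x, f x ∂μ := by
  have hl := measurePreserving_act hT l
  have h := integral_map (f := f) hl.aemeasurable (by rwa [hl.map_eq])
  rw [hl.map_eq] at h
  exact h.symm

end Action

/-! ### Fourier analysis on the torus and the spectral density. -/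

section Torus

variable {d : ℕ}

open UnitAddTorus

instance isProbabilityMeasure_torusMeasure (d : ℕ) : IsProbabilityMeasure (torusMeasure d) :=
  inferInstanceAs (IsProbabilityMeasure (Measure.pi fun _ : Fin d => AddCircle.haarAddCircle))

theorem norm_mFourier_apply (k : Lattice d) (t : Torus d) : ‖mFourier k t‖ = 1 := by
  simp only [mFourier, ContinuousMap.coe_mk, norm_prod, fourier_apply, Circle.norm_coe,
    Finset.prod_const_one]

theorem integral_fourier (n : ℤ) :
    ∫ t : AddCircle (1 : ℝ), fourier n t ∂AddCircle.haarAddCircle = if n = 0 then 1 else 0 := by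
  split_ifs with h
  · simp [h]
  -- Translation by half a period of the character changes its sign.
  · exact integral_eq_zero_of_add_right_eq_neg (μ := AddCircle.haarAddCircle)
      (fourier_add_half_inv_index h one_pos)

theorem integral_mFourier (k : Lattice d) :
    ∫ t, mFourier k t ∂(torusMeasure d) = if k = 0 then 1 else 0 := by
  have h : ∫ t, mFourier k t ∂(torusMeasure d) =
      ∏ i, ∫ t : AddCircle (1 : ℝ), fourier (k i) t ∂AddCircle.haarAddCircle :=
    integral_fintype_prod_eq_prod (fun i (t : AddCircle (1 : ℝ)) => (fourier (k i) t : ℂ))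
  rw [h]
  simp_rw [integral_fourier]
  split_ifs with hk
  · simp [hk]
  · obtain ⟨i, hi⟩ := Function.ne_iff.1 hk
    exact Finset.prod_eq_zero (Finset.mem_univ i) (if_neg hi)

theorem continuous_trigSum {v : Lattice d → ℝ} (hv : Summable fun l => |v l|) :
    Continuous (trigSum v) := by
  refine continuous_tsum (fun l => by fun_prop) hv fun l t => ?_
  simp [norm_mFourier_apply]

theorem integrable_of_continuous {F : Type*} [NormedAddCommGroup F] {g : Torus d → F}
    (hg : Continuous g) : Integrable g (torusMeasure d) :=
  hg.integrable_of_hasCompactSupport (HasCompactSupport.of_compactSpace g)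

theorem conj_trigSum (v : Lattice d → ℝ) (t : Torus d) :
    (starRingEnd ℂ) (trigSum v t) = ∑' l, (v l : ℂ) * mFourier (-l) t := by
  rw [trigSum, Complex.conj_tsum]
  simp [mFourier_neg]

/-- An absolutely summable even family is the family of Fourier coefficients of a real continuous
function. -/
theorem exists_hasSum_mFourier {c : Lattice d → ℝ} (hc : Summable fun k => |c k|)
    (hneg : ∀ k, c (-k) = c k) :
    ∃ φ : C(Torus d, ℝ), ∀ t, HasSum (fun k => (c k : ℂ) * mFourier (-k) t) (φ t : ℂ) := by
  have hs : ∀ t, Summable fun k => (c k : ℂ) * mFourier (-k) t := fun t =>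
    Summable.of_norm (by simpa [norm_mFourier_apply] using hc)
  have hcont : Continuous fun t : Torus d => ∑' k, (c k : ℂ) * mFourier (-k) t := by
    refine continuous_tsum (fun l => by fun_prop) hc fun l t => ?_
    simp [norm_mFourier_apply]
  refine ⟨⟨fun t => (∑' k, (c k : ℂ) * mFourier (-k) t).re, by fun_prop⟩, fun t => ?_⟩
  -- Conjugation replaces `k` by `-k`, which evenness of `c` undoes.
  have hreal : (starRingEnd ℂ) (∑' k, (c k : ℂ) * mFourier (-k) t) =
      ∑' k, (c k : ℂ) * mFourier (-k) t := by
    rw [Complex.conj_tsum, ← (Equiv.neg (Lattice d)).tsum_eq]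
    simp [mFourier_neg, hneg]
  rw [ContinuousMap.coe_mk, Complex.conj_eq_iff_re.1 hreal]
  exact (hs t).hasSum

variable {c : Lattice d → ℝ} {φ : C(Torus d, ℝ)}

theorem hasSum_integral_mul (hc : Summable fun k => |c k|)
    (hφ : ∀ t, HasSum (fun k => (c k : ℂ) * mFourier (-k) t) (φ t : ℂ)) {g : Torus d → ℂ}
    (hg : Integrable g (torusMeasure d)) :
    HasSum (fun k => (c k : ℂ) * ∫ t, g t * mFourier (-k) t ∂(torusMeasure d))
      (∫ t, g t * (φ t : ℂ) ∂(torusMeasure d)) := by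
  have := hasSum_integral_of_dominated_convergence (μ := torusMeasure d)
    (F := fun (k : Lattice d) t => g t * ((c k : ℂ) * mFourier (-k) t))
    (f := fun t => g t * (φ t : ℂ)) (fun k t => ‖g t‖ * |c k|) ?_ ?_ ?_ ?_ ?_
  · refine this.congr_fun fun k => ?_
    rw [← integral_const_mul]
    refine integral_congr_ae (ae_of_all _ fun t => ?_)
    ring
  · intro k
    exact hg.aestronglyMeasurable.mul (by fun_prop : Continuous fun t : Torus d =>
      (c k : ℂ) * mFourier (-k) t).aestronglyMeasurable
  · exact fun k => ae_of_all _ fun t => by simp [norm_mFourier_apply]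
  · exact ae_of_all _ fun t => hc.mul_left _
  · simp_rw [tsum_mul_left]
    exact hg.norm.mul_const _
  · exact ae_of_all _ fun t => (hφ t).mul_left _

theorem integral_mFourier_mul (hc : Summable fun k => |c k|)
    (hφ : ∀ t, HasSum (fun k => (c k : ℂ) * mFourier (-k) t) (φ t : ℂ)) (k : Lattice d) :
    (c k : ℂ) = ∫ t, mFourier k t * (φ t : ℂ) ∂(torusMeasure d) := by
  have h := hasSum_integral_mul hc hφ
    (integrable_of_continuous (by fun_prop : Continuous fun t : Torus d => mFourier k t))
  have h0 : ∀ p, (c p : ℂ) * ∫ t, mFourier k t * mFourier (-p) t ∂(torusMeasure d) =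
      if p = k then (c k : ℂ) else 0 := by
    intro p
    simp_rw [← mFourier_add]
    rw [integral_mFourier, ← sub_eq_add_neg]
    split_ifs with h1 h2 h2
    · rw [h2, mul_one]
    · exact absurd (sub_eq_zero.1 h1).symm h2
    · exact absurd (sub_eq_zero.2 h2.symm) h1
    · rw [mul_zero]
  simp_rw [h0] at h
  exact (hasSum_ite_eq k (c k : ℂ)).unique h

/-- Covariances of weighted sums in terms of the spectral density. -/
theorem integral_tsum_mul_tsum {E : Type*} [MeasurableSpace E] {μ : Measure E}
    [IsProbabilityMeasure μ] {X : Lattice d → E → ℝ} (hX : ∀ l, AEStronglyMeasurable (X l) μ)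
    {M : ℝ} (hM : ∀ l, ∀ᵐ x ∂μ, ‖X l x‖ ≤ M) (hcX : ∀ k l, ∫ x, X k x * X l x ∂μ = c (k - l))
    (hc : ∀ k, (c k : ℂ) = ∫ t, mFourier k t * (φ t : ℂ) ∂(torusMeasure d))
    {u v : Lattice d → ℝ} (hu : Summable fun l => |u l|) (hv : Summable fun l => |v l|) :
    ((∫ x, (∑' l, u l * X l x) * (∑' l, v l * X l x) ∂μ : ℝ) : ℂ) =
      ∫ t, trigSum u t * (starRingEnd ℂ) (trigSum v t) * (φ t : ℂ) ∂(torusMeasure d) := by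
  -- Both sides expand as the same double series in `(k, l)` with weights `u k * v l`. On the torus
  -- side `φ` is absorbed into the second factor, whence the bound `max 1 ‖φ‖`.
  have h1 := hasSum_integral_prod (μ := μ) ![u, v] (by simpa [Fin.forall_fin_two] using ⟨hu, hv⟩)
    (fun _ l => X l) (fun _ l => hX l) (fun _ l => hM l)
  have h2 := hasSum_integral_prod (μ := torusMeasure d) (𝕜 := ℂ)
    ![fun l => (u l : ℂ), fun l => (v l : ℂ)] (by simpa [Fin.forall_fin_two] using ⟨hu, hv⟩)
    ![fun l t => mFourier l t, fun l t => mFourier (-l) t * (φ t : ℂ)]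
    (by
      rw [Fin.forall_fin_two]
      exact ⟨fun l => (by fun_prop : Continuous fun t : Torus d =>
          mFourier l t).aestronglyMeasurable,
        fun l => (by fun_prop : Continuous fun t : Torus d =>
          mFourier (-l) t * (φ t : ℂ)).aestronglyMeasurable⟩)
    (M := max 1 ‖φ‖)
    (by
      rw [Fin.forall_fin_two]
      refine ⟨fun l => ae_of_all _ fun t => ?_, fun l => ae_of_all _ fun t => ?_⟩
      · simp [norm_mFourier_apply]
      · have := φ.norm_coe_le_norm t
        simp only [Matrix.cons_val_one, Matrix.cons_val_fin_one, norm_mul, norm_mFourier_apply,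
          one_mul, Complex.norm_real]
        exact this.trans (le_max_right _ _))
  simp only [Fin.prod_univ_two, Matrix.cons_val_zero, Matrix.cons_val_one,
    Matrix.cons_val_fin_one] at h1 h2
  have h3 := Complex.hasSum_ofReal.2 h1
  refine (HasSum.unique ?_ h2).trans ?_
  · refine h3.congr_fun fun l => ?_
    rw [hcX]
    push_cast
    rw [hc]
    congr 1
    refine integral_congr_ae (ae_of_all _ fun t => ?_)
    simp only
    rw [← mul_assoc, ← mFourier_add, sub_eq_add_neg]
  · refine integral_congr_ae (ae_of_all _ fun t => ?_)
    simp only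
    rw [conj_trigSum, trigSum, mul_assoc, ← tsum_mul_right (a := (φ t : ℂ))]
    simp only [mul_assoc]

end Torus

/-! ### Asymptotics of the kernels and cross terms. -/

section Weights

variable {d s : ℕ}

theorem summable_sq {v : Lattice d → ℝ} (hv : Summable fun l => |v l|) :
    Summable fun l => v l ^ 2 := by
  refine Summable.of_nonneg_of_le (fun l => sq_nonneg _) (fun l => ?_)
    (hv.mul_left (∑' l, |v l|))
  rw [← sq_abs, sq]
  exact mul_le_mul_of_nonneg_right (hv.le_tsum l fun _ _ => abs_nonneg _) (abs_nonneg _)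

theorem IsSummationSequence.sqSum_pos {w : ℕ → Lattice d → ℝ} (hw : IsSummationSequence w)
    (n : ℕ) : 0 < sqSum (w n) := by
  obtain ⟨h1, h2⟩ := hw n
  obtain ⟨l, hl⟩ : ∃ l, w n l ≠ 0 := by
    by_contra! h
    simp [h] at h2
  exact (summable_sq h1).tsum_pos (fun _ => sq_nonneg _) l (by positivity)

/-- Along a regular summation sequence, the kernels integrate to at most `2` eventually. -/
theorem IsRegular.eventually_integral_kernel_le {ξ : Measure (Torus d)} [IsProbabilityMeasure ξ]
    {w : ℕ → Lattice d → ℝ} (hreg : IsRegular ξ w) :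
    ∀ᶠ n in atTop, ∫ t, kernel (w n) t ∂(torusMeasure d) ≤ 2 := by
  have h := hreg 1
  simp only [ContinuousMap.one_apply, mul_one, integral_const, probReal_univ, smul_eq_mul] at h
  exact (h.eventually (gt_mem_nhds one_lt_two)).mono fun n hn => hn.le

theorem continuous_kernel {v : Lattice d → ℝ} (hv : Summable fun l => |v l|) :
    Continuous (kernel v) :=
  ((continuous_trigSum hv).norm.pow 2).div_const _

theorem norm_mul_conj_div_le {u v : Lattice d → ℝ} (hu : 0 < sqSum u) (hv : 0 < sqSum v)
    (t : Torus d) :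
    ‖trigSum u t * (starRingEnd ℂ) (trigSum v t)‖ / (√(sqSum u) * √(sqSum v)) ≤
      (kernel u t + kernel v t) / 2 := by
  have h1 : ∀ v : Lattice d → ℝ, 0 < sqSum v → kernel v t = (‖trigSum v t‖ / √(sqSum v)) ^ 2 := by
    intro v hv
    rw [kernel, div_pow, Real.sq_sqrt hv.le]
  rw [norm_mul, Complex.norm_conj, mul_div_mul_comm, h1 u hu, h1 v hv]
  linarith [two_mul_le_add_sq (‖trigSum u t‖ / √(sqSum u)) (‖trigSum v t‖ / √(sqSum v))]

theorem isBigO_sqrt {f g : ℕ → ℝ} (h : f =O[atTop] g) (hg : ∀ n, 0 ≤ g n) :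
    (fun n => √(f n)) =O[atTop] fun n => √(g n) := by
  obtain ⟨C, hC⟩ := h.bound
  refine IsBigO.of_bound (√C) (hC.mono fun n hn => ?_)
  rw [Real.norm_of_nonneg (Real.sqrt_nonneg _), Real.norm_of_nonneg (Real.sqrt_nonneg _)]
  rw [Real.norm_of_nonneg (hg n)] at hn
  rw [← Real.sqrt_mul' _ (hg n)]
  exact Real.sqrt_le_sqrt ((le_abs_self _).trans hn)

/-- Dominated convergence over the Fourier modes of `φ`: orthogonality kills each mode, and the
kernel masses, eventually at most 2, dominate mode `p` by `2 |c p|`. -/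
theorem tendsto_integral_cross {c : Lattice d → ℝ} {φ : C(Torus d, ℝ)}
    (hc : Summable fun k => |c k|)
    (hφ : ∀ t, HasSum (fun k => (c k : ℂ) * UnitAddTorus.mFourier (-k) t) (φ t : ℂ))
    {ξ : Fin s → Measure (Torus d)} [∀ j, IsProbabilityMeasure (ξ j)]
    {w : Fin s → ℕ → Lattice d → ℝ} (hw : ∀ j, IsSummationSequence (w j))
    (hreg : ∀ j, IsRegular (ξ j) (w j))
    (hcomp : ∀ j j', (fun n => sqSum (w j n)) =O[atTop] fun n => sqSum (w j' n))
    (hortho : AsymptoticallyOrthogonal w) {j j' : Fin s} (hjj' : j ≠ j') :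
    Tendsto (fun n => (∫ t, trigSum (w j n) t * (starRingEnd ℂ) (trigSum (w j' n) t) * (φ t : ℂ)
      ∂(torusMeasure d)) / ((√(sqSum (w j n)) * √(sqSum (w j' n)) : ℝ) : ℂ)) atTop (𝓝 0) := by
  have hpos : ∀ j n, 0 < sqSum (w j n) := fun j n => (hw j).sqSum_pos n
  have hcont : ∀ n, Continuous fun t => trigSum (w j n) t * (starRingEnd ℂ) (trigSum (w j' n) t) :=
    fun n => (continuous_trigSum (hw j n).1).mul
      (Complex.continuous_conj.comp (continuous_trigSum (hw j' n).1))
  have hsum := fun n => hasSum_integral_mul hc hφ (integrable_of_continuous (hcont n))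
  -- Orthogonality is stated relative to the sum of the squared norms; comparability of the weights
  -- makes this the order of their geometric mean.
  have hO : (fun n => sqSum (w j n) + sqSum (w j' n)) =O[atTop]
      fun n => √(sqSum (w j n)) * √(sqSum (w j' n)) := by
    have h1 := isBigO_sqrt (hcomp j j') fun n => (hpos j' n).le
    have h2 := isBigO_sqrt (hcomp j' j) fun n => (hpos j n).le
    have h3 := (isBigO_refl (fun n => √(sqSum (w j n))) atTop).mul h1
    have h4 := h2.mul (isBigO_refl (fun n => √(sqSum (w j' n))) atTop)
    simp only [Real.mul_self_sqrt (hpos _ _).le] at h3 h4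
    exact h3.add h4
  have hlim : ∀ p, Tendsto (fun n => (c p : ℂ) * ((∫ t, trigSum (w j n) t *
      (starRingEnd ℂ) (trigSum (w j' n) t) * UnitAddTorus.mFourier (-p) t ∂(torusMeasure d)) /
      ((√(sqSum (w j n)) * √(sqSum (w j' n)) : ℝ) : ℂ))) atTop (𝓝 0) := by
    intro p
    have h := (hortho j j' hjj' p).trans_isBigO hO
    rw [← mul_zero (c p : ℂ)]
    refine Tendsto.const_mul _ ?_
    rw [tendsto_zero_iff_norm_tendsto_zero]
    have h' := h.norm_norm.tendsto_div_nhds_zero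
    refine h'.congr fun n => ?_
    rw [norm_div, Complex.norm_real]
  have := tendsto_tsum_of_dominated_convergence (bound := fun p => |c p| * 2) (hc.mul_right 2) hlim
    ?_
  · simp only [tsum_zero] at this
    refine this.congr fun n => ?_
    rw [← (hsum n).tsum_eq, ← tsum_div_const]
    simp_rw [mul_div_assoc]
  · filter_upwards [(hreg j).eventually_integral_kernel_le,
      (hreg j').eventually_integral_kernel_le] with n h1 h2 p
    rw [norm_mul, Complex.norm_real, Real.norm_eq_abs, ← integral_div]
    refine mul_le_mul_of_nonneg_left ?_ (abs_nonneg _)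
    have hi1 := integrable_of_continuous (continuous_kernel (hw j n).1)
    have hi2 := integrable_of_continuous (continuous_kernel (hw j' n).1)
    refine (norm_integral_le_of_norm_le ((hi1.add hi2).div_const 2) (ae_of_all _ fun t => ?_)).trans
      ?_
    · rw [norm_div, norm_mul, norm_mFourier_apply, mul_one, Complex.norm_real,
        Real.norm_of_nonneg (by positivity)]
      exact norm_mul_conj_div_le (hpos j n) (hpos j' n) t
    · rw [integral_div]
      have := integral_add hi1 hi2
      simp only [Pi.add_apply]
      linarith

end Weights

theorem ae_norm_le_of_memLp_top {E F : Type*} [MeasurableSpace E] [NormedAddCommGroup F]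
    {μ : Measure E} {f : E → F} (hf : MemLp f ⊤ μ) :
    ∀ᵐ x ∂μ, ‖f x‖ ≤ (eLpNormEssSup f μ).toReal := by
  have hlt : eLpNormEssSup f μ < ⊤ := eLpNorm_exponent_top (f := f) (μ := μ) ▸ hf.eLpNorm_lt_top
  filter_upwards [ae_le_eLpNormEssSup (f := f) (μ := μ)] with x hx
  rw [← toReal_enorm]
  exact ENNReal.toReal_mono hlt.ne hx

/-! ### Measurability and boundedness of the weighted sums. -/

section Series

variable {E : Type*} [MeasurableSpace E] {μ : Measure E} {d s : ℕ} {X : Lattice d → E → ℝ} {M : ℝ}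

theorem aemeasurable_tsum_mul (hX : ∀ l, AEStronglyMeasurable (X l) μ) (v : Lattice d → ℝ) :
    AEMeasurable (fun x => ∑' l, v l * X l x) μ :=
  AEMeasurable.tsum fun l => (hX l).aemeasurable.const_mul _

theorem ae_abs_tsum_mul_le (hM : ∀ l, ∀ᵐ x ∂μ, ‖X l x‖ ≤ M) {v : Lattice d → ℝ}
    (hv : Summable fun l => |v l|) :
    ∀ᵐ x ∂μ, (Summable fun l => v l * X l x) ∧ |∑' l, v l * X l x| ≤ (∑' l, |v l|) * M := by
  filter_upwards [ae_all_iff.2 hM] with x hx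
  have hs : Summable fun l => ‖v l * X l x‖ :=
    Summable.of_nonneg_of_le (fun _ => norm_nonneg _) (fun l => norm_mul_le_of_le_bound (hx l))
      (hv.mul_right M)
  refine ⟨hs.of_norm, (norm_tsum_le_tsum_norm hs).trans ?_⟩
  rw [← tsum_mul_right]
  exact hs.tsum_le_tsum (fun l => norm_mul_le_of_le_bound (hx l)) (hv.mul_right M)

theorem aemeasurable_normalizedSums (hX : ∀ l, AEStronglyMeasurable (X l) μ)
    (w : Fin s → ℕ → Lattice d → ℝ) (n : ℕ) : AEMeasurable (normalizedSums X w n) μ :=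
  (WithLp.measurable_toLp 2 _).comp_aemeasurable
    (aemeasurable_pi_lambda _ fun _ => (aemeasurable_tsum_mul hX _).div_const _)

theorem ae_abs_normalizedSums_le (hM : ∀ l, ∀ᵐ x ∂μ, ‖X l x‖ ≤ M)
    {w : Fin s → ℕ → Lattice d → ℝ} (hw : ∀ j, IsSummationSequence (w j)) (n : ℕ) (j : Fin s) :
    ∃ C, ∀ᵐ x ∂μ, |normalizedSums X w n x j| ≤ C := by
  refine ⟨(∑' l, |w j n l|) * M / √(sqSum (w j n)), ?_⟩
  filter_upwards [ae_abs_tsum_mul_le hM (hw j n).1] with x hx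
  simp only [normalizedSums]
  rw [abs_div, abs_of_nonneg (Real.sqrt_nonneg _)]
  exact div_le_div_of_nonneg_right hx.2 (Real.sqrt_nonneg _)

end Series

/-! ### Limits of covariances, cumulants and characteristic functions. -/

section Limit

variable {E : Type*} [MeasurableSpace E] {μ : Measure E} [IsProbabilityMeasure μ] {d s : ℕ}
  {X : Lattice d → E → ℝ} {M : ℝ} {c : Lattice d → ℝ} {φ : C(Torus d, ℝ)}

theorem integral_tsum_mul (hX : ∀ l, AEStronglyMeasurable (X l) μ)
    (hM : ∀ l, ∀ᵐ x ∂μ, ‖X l x‖ ≤ M) (h0 : ∀ l, ∫ x, X l x ∂μ = 0) {v : Lattice d → ℝ}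
    (hv : Summable fun l => |v l|) : ∫ x, ∑' l, v l * X l x ∂μ = 0 := by
  have h := hasSum_integral_prod (μ := μ) (r := 1) (fun _ => v) (fun _ => hv) (fun _ => X)
    (fun _ => hX) fun _ => hM
  simp only [Finset.univ_unique, Finset.prod_singleton, h0, mul_zero] at h
  exact h.unique hasSum_zero

theorem tendsto_covariance (hX : ∀ l, AEStronglyMeasurable (X l) μ)
    (hM : ∀ l, ∀ᵐ x ∂μ, ‖X l x‖ ≤ M) (hcX : ∀ k l, ∫ x, X k x * X l x ∂μ = c (k - l))
    (hc : Summable fun k => |c k|)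
    (hφ : ∀ t, HasSum (fun k => (c k : ℂ) * UnitAddTorus.mFourier (-k) t) (φ t : ℂ))
    {ξ : Fin s → Measure (Torus d)} [∀ j, IsProbabilityMeasure (ξ j)]
    {w : Fin s → ℕ → Lattice d → ℝ} (hw : ∀ j, IsSummationSequence (w j))
    (hreg : ∀ j, IsRegular (ξ j) (w j))
    (hcomp : ∀ j j', (fun n => sqSum (w j n)) =O[atTop] fun n => sqSum (w j' n))
    (hortho : AsymptoticallyOrthogonal w) (j j' : Fin s) :
    Tendsto (fun n => ∫ x, normalizedSums X w n x j * normalizedSums X w n x j' ∂μ) atTop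
      (𝓝 (if j = j' then ∫ t, φ t ∂(ξ j) else 0)) := by
  have hcov : ∀ n, ((∫ x, normalizedSums X w n x j * normalizedSums X w n x j' ∂μ : ℝ) : ℂ) =
      (∫ t, trigSum (w j n) t * (starRingEnd ℂ) (trigSum (w j' n) t) * (φ t : ℂ)
      ∂(torusMeasure d)) / ((√(sqSum (w j n)) * √(sqSum (w j' n)) : ℝ) : ℂ) := by
    intro n
    rw [← integral_tsum_mul_tsum hX hM hcX (integral_mFourier_mul hc hφ) (hw j n).1 (hw j' n).1,
      ← Complex.ofReal_div, ← integral_div]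
    simp only [normalizedSums, div_mul_div_comm]
  split_ifs with h
  · subst h
    refine (hreg j φ).congr fun n => ?_
    apply Complex.ofReal_injective
    rw [hcov, ← integral_complex_ofReal, ← integral_div]
    refine integral_congr_ae (ae_of_all _ fun t => ?_)
    simp only [kernel]
    rw [Complex.mul_conj, Complex.normSq_eq_norm_sq, Real.mul_self_sqrt ((hw j).sqSum_pos n).le]
    push_cast
    ring
  · have := tendsto_integral_cross hc hφ hw hreg hcomp hortho h
    simp_rw [← hcov] at this
    exact (Complex.continuous_re.tendsto _).comp this

theorem memLp_normalizedSums (hX : ∀ l, AEStronglyMeasurable (X l) μ)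
    (hM : ∀ l, ∀ᵐ x ∂μ, ‖X l x‖ ≤ M) {w : Fin s → ℕ → Lattice d → ℝ}
    (hw : ∀ j, IsSummationSequence (w j)) (n : ℕ) (j : Fin s) (p : ENNReal) :
    MemLp (fun x => normalizedSums X w n x j) p μ := by
  obtain ⟨C, hC⟩ := ae_abs_normalizedSums_le (X := X) hM hw n j
  exact MemLp.of_bound ((aemeasurable_tsum_mul hX _).div_const _).aestronglyMeasurable C hC

/-- Expansion of the cumulants of linear combinations of the normalized sums. -/
theorem cumulant_linear_combination (hX : ∀ l, AEStronglyMeasurable (X l) μ)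
    (hM : ∀ l, ∀ᵐ x ∂μ, ‖X l x‖ ≤ M) {w : Fin s → ℕ → Lattice d → ℝ}
    (hw : ∀ j, IsSummationSequence (w j)) (a : Fin s → ℝ) (n r : ℕ) :
    cumulant μ (fun _ : Fin r => fun x => ∑ j, a j * normalizedSums X w n x j) =
      ∑ i : Fin r → Fin s, (∏ k, a (i k) / √(sqSum (w (i k) n))) *
        ∑' l : Fin r → Lattice d, (∏ k, w (i k) n (l k)) * cumulant μ fun k => X (l k) := by
  -- The linear combination becomes one series over `Fin s × ℤ^d`, so `hasSum_cumulant` applies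
  -- directly; splitting the index afterwards recovers the finite sum over `i`.
  set v : Fin s × Lattice d → ℝ := fun p => a p.1 / √(sqSum (w p.1 n)) * w p.1 n p.2 with hv
  have hvs : Summable fun p => ‖v p‖ := by
    rw [summable_prod_of_nonneg fun _ => norm_nonneg _]
    refine ⟨fun j => ?_, (hasSum_fintype _).summable⟩
    simp only [hv, norm_mul]
    exact (hw j n).1.mul_left _
  have hY : (fun x => ∑ j, a j * normalizedSums X w n x j) =ᵐ[μ]
      fun x => ∑' p, v p * X p.2 x := by
    filter_upwards [ae_all_iff.2 hM] with x hx
    have hs : Summable fun p => v p * X p.2 x :=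
      (Summable.of_nonneg_of_le (fun _ => norm_nonneg _)
        (fun p => norm_mul_le_of_le_bound (hx p.2)) (hvs.mul_right M)).of_norm
    rw [hs.tsum_prod, tsum_fintype]
    refine Finset.sum_congr rfl fun j _ => ?_
    simp only [hv, normalizedSums, mul_assoc]
    rw [tsum_mul_left]
    ring
  have h1 : cumulant μ (fun _ : Fin r => fun x => ∑ j, a j * normalizedSums X w n x j) =
      cumulant μ fun _ : Fin r => fun x => ∑' p, v p * X p.2 x := by
    rw [cumulant_const, cumulant_const]
    congr 1
    ext q
    refine integral_congr_ae (hY.mono fun x hx => ?_)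
    simp only [hx]
  have h2 := hasSum_cumulant (μ := μ) (X := fun p : Fin s × Lattice d => X p.2)
    (fun p => hX p.2) (fun p => hM p.2) hvs r
  have h3 := (Equiv.arrowProdEquivProdArrow (Fin r) (fun _ => Fin s)
    fun _ => Lattice d).symm.summable_iff.2 h2.summable
  rw [h1, ← h2.tsum_eq,
    ← (Equiv.arrowProdEquivProdArrow (Fin r) (fun _ => Fin s) fun _ => Lattice d).symm.tsum_eq]
  refine (Summable.tsum_prod h3).trans ?_
  rw [tsum_fintype]
  refine Finset.sum_congr rfl fun i _ => ?_
  rw [← tsum_mul_left]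
  refine tsum_congr fun l => ?_
  simp only [hv, Equiv.arrowProdEquivProdArrow, Equiv.coe_fn_symm_mk, Function.comp_apply,
    Finset.prod_mul_distrib]
  ring

/-- The total squared norm is comparable to each individual one, so `r` normalizing factors absorb
its power `r / 2` and turn the assumed little-o into `o(1)`. -/
theorem tendsto_cumulant_linear_combination (hX : ∀ l, AEStronglyMeasurable (X l) μ)
    (hM : ∀ l, ∀ᵐ x ∂μ, ‖X l x‖ ≤ M) {w : Fin s → ℕ → Lattice d → ℝ}
    (hw : ∀ j, IsSummationSequence (w j))
    (hcomp : ∀ j j', (fun n => sqSum (w j n)) =O[atTop] fun n => sqSum (w j' n))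
    (hcum : NegligibleCumulants μ X w) (a : Fin s → ℝ) {r : ℕ} (hr : 3 ≤ r) :
    Tendsto (fun n => cumulant μ fun _ : Fin r => fun x => ∑ j, a j * normalizedSums X w n x j)
      atTop (𝓝 0) := by
  simp_rw [cumulant_linear_combination hX hM hw a]
  rw [← Finset.sum_const_zero (s := (Finset.univ : Finset (Fin r → Fin s)))]
  refine tendsto_finsetSum _ fun i _ => ?_
  rw [← isLittleO_one_iff ℝ]
  have htot : ∀ n, ∑' l : Lattice d, ∑ j, w j n l ^ 2 = ∑ j, sqSum (w j n) := fun n =>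
    Summable.tsum_finsetSum fun j _ => summable_sq (hw j n).1
  have htot0 : ∀ n, 0 ≤ ∑ j, sqSum (w j n) := fun n =>
    Finset.sum_nonneg fun j _ => ((hw j).sqSum_pos n).le
  have hbig : ∀ j, (fun n => a j / √(sqSum (w j n)) * √(∑ j, sqSum (w j n))) =O[atTop]
      fun _ => (1 : ℝ) := by
    intro j
    have h1 : (fun n => ∑ j, sqSum (w j n)) =O[atTop] fun n => sqSum (w j n) := by
      have := IsBigO.sum (s := Finset.univ) fun j' _ => hcomp j' j
      exact this.congr_left fun n => by simp
    have h2 := isBigO_sqrt h1 fun n => ((hw j).sqSum_pos n).le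
    have h3 := (isBigO_refl (fun n => a j / √(sqSum (w j n))) atTop).mul h2
    refine h3.trans (IsBigO.of_bound |a j| (Eventually.of_forall fun n => ?_))
    rw [div_mul_cancel₀ _ (Real.sqrt_pos.2 ((hw j).sqSum_pos n)).ne']
    simp
  have hprod := IsBigO.finsetProd (s := (Finset.univ : Finset (Fin r))) fun k _ => hbig (i k)
  simp only [Finset.prod_mul_distrib, Finset.prod_const, Finset.card_univ, Fintype.card_fin,
    one_pow] at hprod
  refine ((isBigO_refl _ atTop).mul_isLittleO (hcum r hr i)).trans_isBigO ?_
  refine hprod.congr_left fun n => ?_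
  rw [htot, Real.sqrt_eq_rpow, ← Real.rpow_mul_natCast (htot0 n)]
  congr 2
  ring

theorem tendsto_integral_exp_normalizedSums (hX : ∀ l, AEStronglyMeasurable (X l) μ)
    (hM : ∀ l, ∀ᵐ x ∂μ, ‖X l x‖ ≤ M) (h0 : ∀ l, ∫ x, X l x ∂μ = 0)
    (hcX : ∀ k l, ∫ x, X k x * X l x ∂μ = c (k - l)) (hc : Summable fun k => |c k|)
    (hφ : ∀ t, HasSum (fun k => (c k : ℂ) * UnitAddTorus.mFourier (-k) t) (φ t : ℂ))
    {ξ : Fin s → Measure (Torus d)} [∀ j, IsProbabilityMeasure (ξ j)]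
    {w : Fin s → ℕ → Lattice d → ℝ} (hw : ∀ j, IsSummationSequence (w j))
    (hreg : ∀ j, IsRegular (ξ j) (w j))
    (hcomp : ∀ j j', (fun n => sqSum (w j n)) =O[atTop] fun n => sqSum (w j' n))
    (hortho : AsymptoticallyOrthogonal w) (hcum : NegligibleCumulants μ X w) (a : Fin s → ℝ) :
    Tendsto (fun n => ∫ x, Complex.exp ((∑ j, a j * normalizedSums X w n x j : ℝ) * Complex.I) ∂μ)
      atTop (𝓝 (Complex.exp (-((∑ j, a j ^ 2 * ∫ t, φ t ∂(ξ j) : ℝ) : ℂ) / 2))) := by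
  have hmem := fun n j p => memLp_normalizedSums hX hM hw n j p
  refine tendsto_integral_exp_of_tendsto_cumulant
    (Y := fun n x => ∑ j, a j * normalizedSums X w n x j) ?_ ?_ ?_ ?_ ?_
  · intro n
    exact Finset.aemeasurable_fun_sum _ fun j _ =>
      ((hmem n j 1).aestronglyMeasurable.aemeasurable.const_mul _)
  · intro n
    choose C hC using ae_abs_normalizedSums_le (X := X) hM hw n
    refine ⟨∑ j, |a j| * C j, ?_⟩
    filter_upwards [ae_all_iff.2 hC] with x hx
    refine (Finset.abs_sum_le_sum_abs _ _).trans (Finset.sum_le_sum fun j _ => ?_)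
    rw [abs_mul]
    exact mul_le_mul_of_nonneg_left (hx j) (abs_nonneg _)
  · intro n
    rw [integral_finsetSum _ fun j _ => ((hmem n j 1).integrable le_rfl).const_mul _]
    refine Finset.sum_eq_zero fun j _ => ?_
    simp only [normalizedSums]
    rw [integral_const_mul, integral_div, integral_tsum_mul hX hM h0 (hw j n).1]
    simp
  · have hsq : ∀ n, ∫ x, (∑ j, a j * normalizedSums X w n x j) ^ 2 ∂μ = ∑ j, ∑ j', a j * a j' *
        ∫ x, normalizedSums X w n x j * normalizedSums X w n x j' ∂μ := by
      intro n
      have hint : ∀ j j', Integrable (fun x => a j * a j' *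
          (normalizedSums X w n x j * normalizedSums X w n x j')) μ := fun j j' =>
        ((hmem n j 2).integrable_mul (hmem n j' 2)).const_mul _
      simp_rw [← integral_const_mul]
      simp_rw [← integral_finsetSum _ fun j' _ => hint _ j']
      rw [← integral_finsetSum _ fun j _ => integrable_finsetSum _ fun j' _ => hint j j']
      refine integral_congr_ae (ae_of_all _ fun x => ?_)
      simp only [sq, Finset.sum_mul_sum]
      refine Finset.sum_congr rfl fun j _ => Finset.sum_congr rfl fun j' _ => ?_
      ring
    simp_rw [hsq]
    have hlim : ∑ j, a j ^ 2 * ∫ t, φ t ∂(ξ j) =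
        ∑ j, ∑ j', a j * a j' * (if j = j' then ∫ t, φ t ∂(ξ j) else 0) := by
      refine Finset.sum_congr rfl fun j _ => ?_
      simp [sq]
    rw [hlim]
    exact tendsto_finsetSum _ fun j _ => tendsto_finsetSum _ fun j' _ =>
      (tendsto_covariance hX hM hcX hc hφ hw hreg hcomp hortho j j').const_mul _
  · exact fun r hr => tendsto_cumulant_linear_combination hX hM hw hcomp hcum a hr

end Limit

end WeightedCLT

/-! ### The central limit theorem. -/

theorem proposition3p3 {E : Type*} [MeasurableSpace E] (μ : Measure E) [IsProbabilityMeasure μ]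
    {d s : ℕ} (T : Fin d → E ≃ᵐ E) (hT : WeightedCLT.IsCommutingAction μ T)
    (f : E → ℝ) (hf : MemLp f ⊤ μ) (hf0 : ∫ x, f x ∂μ = 0)
    (hcorr : Summable fun k => |WeightedCLT.correlation μ T f k|)
    (ξ : Fin s → Measure (WeightedCLT.Torus d)) [∀ j, IsProbabilityMeasure (ξ j)]
    (w : Fin s → ℕ → WeightedCLT.Lattice d → ℝ)
    (hw : ∀ j, WeightedCLT.IsSummationSequence (w j))
    (hreg : ∀ j, WeightedCLT.IsRegular (ξ j) (w j))
    (hcomp : ∀ j j', (fun n => WeightedCLT.sqSum (w j n)) =O[atTop]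
      fun n => WeightedCLT.sqSum (w j' n))
    (hortho : WeightedCLT.AsymptoticallyOrthogonal w)
    (hcum : WeightedCLT.NegligibleCumulants μ (WeightedCLT.field T f) w) :
    ∃ φ : C(WeightedCLT.Torus d, ℝ), WeightedCLT.IsSpectralDensity μ T f φ ∧
      (∀ j, 0 ≤ ∫ t, φ t ∂(ξ j)) ∧
      TendstoInDistribution (WeightedCLT.normalizedSums (WeightedCLT.field T f) w) atTop id
        (fun _ => μ)
        (multivariateGaussian 0 (Matrix.diagonal fun j => ∫ t, φ t ∂(ξ j))) := by
  obtain ⟨φ, hφ⟩ := WeightedCLT.exists_hasSum_mFourier hcorr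
    (WeightedCLT.correlation_neg hT hf.aestronglyMeasurable)
  have hX := WeightedCLT.aestronglyMeasurable_field hT hf.aestronglyMeasurable
  have h0 : ∀ l, ∫ x, WeightedCLT.field T f l x ∂μ = 0 := fun l =>
    (WeightedCLT.integral_field hT hf.aestronglyMeasurable l).trans hf0
  have hcX := WeightedCLT.integral_field_mul_field hT hf.aestronglyMeasurable
  have hM : ∀ l, ∀ᵐ x ∂μ, ‖WeightedCLT.field T f l x‖ ≤ (eLpNormEssSup f μ).toReal := fun l =>
    (WeightedCLT.measurePreserving_act hT l).quasiMeasurePreserving.ae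
      (WeightedCLT.ae_norm_le_of_memLp_top hf)
  -- Each value is a limit of second moments. Nonnegativity is also what makes the diagonal matrix a
  -- covariance in the Gaussian characteristic function.
  have hnonneg : ∀ j, 0 ≤ ∫ t, φ t ∂(ξ j) := by
    intro j
    have h := WeightedCLT.tendsto_covariance hX hM hcX hcorr hφ hw hreg hcomp hortho j j
    rw [if_pos rfl] at h
    exact ge_of_tendsto' h fun n => integral_nonneg fun x => mul_self_nonneg _
  refine ⟨φ, WeightedCLT.integral_mFourier_mul hcorr hφ, hnonneg,
    ⟨WeightedCLT.aemeasurable_normalizedSums hX w, aemeasurable_id, ?_⟩⟩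
  refine ProbabilityMeasure.tendsto_iff_tendsto_charFun.2 fun t => ?_
  have hlim := WeightedCLT.tendsto_integral_exp_normalizedSums hX hM h0 hcX hcorr hφ hw hreg hcomp
    hortho hcum t
  have hgauss : charFun (multivariateGaussian 0 (Matrix.diagonal fun j => ∫ t, φ t ∂(ξ j))) t =
      Complex.exp (-((∑ j, t j ^ 2 * ∫ t, φ t ∂(ξ j) : ℝ) : ℂ) / 2) := by
    rw [charFun_multivariateGaussian (Matrix.PosSemidef.diagonal hnonneg)]
    congr 1
    simp only [inner_zero_right, Complex.ofReal_zero, zero_mul, zero_sub, neg_div]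
    congr 3
    simp only [dotProduct, Matrix.mulVec_diagonal]
    refine Finset.sum_congr rfl fun j _ => ?_
    ring
  simp only [ProbabilityMeasure.coe_mk, Measure.map_id]
  rw [hgauss]
  refine hlim.congr fun n => ?_
  rw [charFun_apply, integral_map (WeightedCLT.aemeasurable_normalizedSums hX w n)
    (by fun_prop : Continuous _).aestronglyMeasurable]
  simp [PiLp.inner_apply]
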